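/- Let $S^1=\mathbb{R}/\mathbb{Z}$ be the circle of unit circumference and, for $x,y\in S^1$, let $\vec d(x,y)\in[0,1)$ be the clockwise distance from $x$ to $y$. For a finite set $X\subseteq S^1$ and $0<r\le 1$, let $f_r\colon X\to X$ map $x$ to the point $y\in X$ with $\vec d(x,y)<r$ for which $\vec d(x,y)$ is largest. A point $x\in X$ is periodic if $f_r^i(x)=x$ for some $i\ge 1$; its periodic orbit is then $\{f_r^i(x) : i\ge 0\}$, the length $\ell$ of the orbit is the smallest such $i$, and its winding number is the number of times that the closed walk $x\to f_r(x)\to\cdots\to f_r^{\ell}(x)=x$ wraps clockwise around the circle, that is, $w=\sum_{i=0}^{\ell-1}\vec d(f_r^i(x),f_r^{i+1}(x))$. Theorem. Let $0<r\le 1$ be rational, $r=\frac pq$ with $p,q$ coprime positive integers, and for each $n$ let $X_n\subseteq S^1$ be a set of $n$ points sampled independently and uniformly at random. Then, with probability tending to $1$ as $n\to\infty$, the map $f_r\colon X_n\to X_n$ has exactly one periodic orbit, and the length $\ell_n$ and the winding number $w_n$ of this orbit are integers with $\ell_n p-w_n q=1$. -/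

import Mathlib

open Filter Topology MeasureTheory ProbabilityTheory

noncomputable section

/-- The clockwise distance from `x` to `y` on the circle `ℝ / ℤ` of unit circumference: the unique
representative in `[0, 1)` of `y - x` (the clockwise direction is the positive one). -/
def cwDist (x y : UnitAddCircle) : ℝ :=
  (AddCircle.equivIco 1 0 (y - x) : ℝ)

theorem cwDist_self (x : UnitAddCircle) : cwDist x x = 0 := by
  have h := AddCircle.equivIco_coe_eq (p := (1 : ℝ)) (a := 0) (x := 0) (by norm_num)
  simp only [cwDist, sub_self]
  exact congrArg Subtype.val h

theorem cwDist_injective (x : UnitAddCircle) : Function.Injective (cwDist x) := by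
  intro y z h
  exact sub_left_injective ((AddCircle.equivIco 1 0).injective (Subtype.ext h))

/-- Among the points of `X` in the clockwise half-open arc `[x, x + r)` there is one at the largest
clockwise distance from `x`. -/
theorem exists_cw_furthest (X : Finset UnitAddCircle) (r : ℝ) (hr : 0 < r) (x : X) :
    ∃ y : X, cwDist x y < r ∧ ∀ z : X, cwDist x z < r → cwDist x z ≤ cwDist x y := by
  classical
  obtain ⟨y, hy, hmax⟩ := Finset.exists_max_image
    (Finset.univ.filter fun y : X => cwDist x y < r) (fun y => cwDist x y)
    ⟨x, by simpa [cwDist_self] using hr⟩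
  refine ⟨y, (Finset.mem_filter.1 hy).2, fun z hz => hmax z ?_⟩
  exact Finset.mem_filter.2 ⟨Finset.mem_univ z, hz⟩

/-- The cyclic dynamical system `f_r : X → X` on a finite set `X` of points of the circle: `f_r x`
is the clockwise furthest element of `X` in the half-open arc `[x, x + r)`. -/
def cyclicMap (X : Finset UnitAddCircle) (r : ℝ) (hr : 0 < r) (x : X) : X :=
  (exists_cw_furthest X r hr x).choose

/-- `f_r x` is characterised by its defining property. -/
theorem cyclicMap_eq_iff (X : Finset UnitAddCircle) (r : ℝ) (hr : 0 < r) (x y : X) :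
    cyclicMap X r hr x = y ↔
      cwDist x y < r ∧ ∀ z : X, cwDist x z < r → cwDist x z ≤ cwDist x y := by
  have hs := (exists_cw_furthest X r hr x).choose_spec
  constructor
  · rintro rfl
    exact hs
  · rintro ⟨h1, h2⟩
    exact Subtype.ext (cwDist_injective x (le_antisymm (h2 _ hs.1) (hs.2 _ h1)))

/-- The set of periodic orbits of a self-map `f`: the sets `{f^i x | i ≥ 0}`, `x` periodic. -/
def periodicOrbits {α : Type*} (f : α → α) : Set (Set α) :=
  {O | ∃ x ∈ Function.periodicPts f, O = Set.range fun i : ℕ => f^[i] x}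

/-- The winding number of the closed walk `x 0 → x 1 → ⋯ → x (s - 1) → x 0` on the circle of unit
circumference: its total clockwise length (`finRotate s` is the cyclic successor). -/
def windingNumber {s : ℕ} (x : Fin s → UnitAddCircle) : ℝ :=
  ∑ i : Fin s, cwDist (x i) (x (finRotate s i))

/-- The periodic orbit of `f : X → X` through the periodic point `x` has length `l` and winding
number `w`. -/
def OrbitHasLengthWinding {X : Finset UnitAddCircle} (f : X → X) (x : X) (l w : ℕ) : Prop :=
  Function.minimalPeriod f x = l ∧
    windingNumber (fun i : Fin l => ((f^[(i : ℕ)] x : X) : UnitAddCircle)) = w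

/-- `f` has exactly one periodic orbit, and the length `l` and the winding number `w` of that orbit
(computed from any of its points) satisfy `l p - w q = 1`. -/
def HasSingleOrbit {X : Finset UnitAddCircle} (f : X → X) (p q : ℕ) : Prop :=
  ∃ O : Set X, periodicOrbits f = {O} ∧
    ∃ l w : ℕ, (∀ x ∈ O, OrbitHasLengthWinding f x l w) ∧ (l : ℤ) * p - (w : ℤ) * q = 1

open Classical in
/-- The finite set of values of an `n`-tuple of points of the circle. -/
def sampleSet {n : ℕ} (x : Fin n → UnitAddCircle) : Finset UnitAddCircle :=
  Finset.univ.image x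

/-- The events `A n` hold asymptotically almost surely: the probability that `A n` fails tends to
`0`. (Stated through the complement, this is the strong reading even for outer measures, so that
measurability of `A n` need not be presupposed.) -/
def AsymptoticallyAlmostSurely {Ω : ℕ → Type*} [∀ n, MeasurableSpace (Ω n)]
    (P : ∀ n, Measure (Ω n)) (A : ∀ n, Set (Ω n)) : Prop :=
  Tendsto (fun n => P n (A n)ᶜ) atTop (𝓝 0)

end

/-! ### Lifts of clockwise walks to the real line -/

/-! View lifts of walks in a frame that advances by `p / q` per step. Each step of `f_r` is shorter
than `p / q`, so the coordinate in this frame strictly decreases: the walk moves to the last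
available point before its current position, and the available points depend only on the time modulo
`q`.

Suppose that from some `b` on the first available points at times `0, …, q - 1` descend
(`HasStaircase`). A walk beyond `b` is then held there by the next stair, and can cross `b` only
when the time becomes divisible by `q`, landing on the last lift `z` of a sample point before `b`.
All walks therefore merge at `z`, and there is one periodic orbit. Restarting from `z`, displaced by
`1 / q` in the frame, gives a closed walk of length `L` and winding number `w` with `L p - w q = 1`;
this identity forces it to go round the orbit once (`HasStaircase.hasSingleOrbit`).

A staircase arises when `q` sample points of consecutive phases (positions modulo `1 / q`) have
prescribed colours in `ZMod q` (`HasBlock.hasStaircase`). Given distinct phases, the colours are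
independent and uniform, so each of the `n / q` disjoint blocks succeeds with probability `q ^
(-q)`, and all fail with probability tending to `0`. -/

theorem coe_add_intCast_circle (u : ℝ) (n : ℤ) : ((u + n : ℝ) : UnitAddCircle) = u := by
  rw [AddCircle.coe_add, add_eq_left, AddCircle.coe_eq_zero_iff]
  exact ⟨n, by simp⟩

theorem coe_add_natCast_circle (u : ℝ) (n : ℕ) : ((u + n : ℝ) : UnitAddCircle) = u := by
  simpa using coe_add_intCast_circle u n

theorem coe_sub_natCast_circle (u : ℝ) (n : ℕ) : ((u - n : ℝ) : UnitAddCircle) = u := by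
  simpa [sub_eq_add_neg] using coe_add_intCast_circle u (-n)

theorem exists_int_of_coe_eq {u v : ℝ} (h : (u : UnitAddCircle) = v) : ∃ n : ℤ, u = v + n := by
  obtain ⟨n, hn⟩ := (AddCircle.coe_eq_zero_iff (1 : ℝ) (x := u - v)).1
    (by rw [AddCircle.coe_sub, h, sub_self])
  refine ⟨n, ?_⟩
  simp only [zsmul_eq_mul, mul_one] at hn
  linarith

theorem cwDist_nonneg (x y : UnitAddCircle) : 0 ≤ cwDist x y :=
  (AddCircle.equivIco 1 0 (y - x)).2.1

theorem coe_cwDist (x y : UnitAddCircle) : (cwDist x y : UnitAddCircle) = y - x :=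
  AddCircle.coe_equivIco

theorem cwDist_coe_of_mem_Ico {u v : ℝ} (h : v ∈ Set.Ico u (u + 1)) :
    cwDist (u : UnitAddCircle) v = v - u := by
  rw [cwDist, ← AddCircle.coe_sub]
  exact AddCircle.equivIco_coe_of_mem ⟨by linarith [h.1], by linarith [h.2]⟩

/-- The lift of `f_r x` above a lift `u` of `x` is the last lift of a point of `X` before `u + r`. -/
theorem isGreatest_add_cwDist_cyclicMap {X : Finset UnitAddCircle} {r : ℝ} (hr : 0 < r)
    (hr1 : r ≤ 1) {x : X} {u : ℝ} (hu : (u : UnitAddCircle) = x) :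
    IsGreatest {w : ℝ | (w : UnitAddCircle) ∈ X ∧ w < u + r}
      (u + cwDist x (cyclicMap X r hr x)) := by
  obtain ⟨h1, h2⟩ := (cyclicMap_eq_iff X r hr x _).1 rfl
  refine ⟨⟨?_, by linarith⟩, ?_⟩
  · rw [AddCircle.coe_add, coe_cwDist, hu, add_sub_cancel]
    exact (cyclicMap X r hr x).2
  · rintro w ⟨hw, hwr⟩
    rcases lt_or_ge w u with h | h
    · linarith [cwDist_nonneg x (cyclicMap X r hr x)]
    · have hd : cwDist x (w : UnitAddCircle) = w - u := by
        rw [← hu]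
        exact cwDist_coe_of_mem_Ico ⟨h, by linarith⟩
      have := h2 ⟨_, hw⟩ (by simp only [hd]; linarith)
      simp only [hd] at this
      linarith

/-- The total clockwise length of the first `n` steps of the orbit of `x`. -/
noncomputable def walkLength {X : Finset UnitAddCircle} (f : X → X) (x : X) (n : ℕ) : ℝ :=
  ∑ i ∈ Finset.range n, cwDist (f^[i] x : X) (f^[i + 1] x : X)

section walkLength

variable {X : Finset UnitAddCircle} (f : X → X)

theorem walkLength_nonneg (x : X) (n : ℕ) : 0 ≤ walkLength f x n :=
  Finset.sum_nonneg fun _ _ => cwDist_nonneg _ _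

theorem walkLength_add (x : X) (m n : ℕ) :
    walkLength f x (m + n) = walkLength f x m + walkLength f (f^[m] x) n := by
  rw [walkLength, Finset.sum_range_add]
  refine congrArg₂ _ rfl (Finset.sum_congr rfl fun i _ => ?_)
  rw [← Function.iterate_add_apply, ← Function.iterate_add_apply, add_comm i m,
    add_right_comm i 1 m, add_comm i m]

theorem walkLength_one (x : X) : walkLength f x 1 = cwDist x (f x) := by
  simp [walkLength]

theorem coe_walkLength (x : X) (n : ℕ) :
    (walkLength f x n : UnitAddCircle) = (f^[n] x : X) - (x : UnitAddCircle) := by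
  induction n with
  | zero => simp [walkLength]
  | succ n ih =>
    rw [walkLength_add, AddCircle.coe_add, ih, walkLength_one, coe_cwDist,
      Function.iterate_succ_apply' f]
    abel

theorem walkLength_mul {x : X} {l : ℕ} (h : Function.IsPeriodicPt f l x) (n : ℕ) :
    walkLength f x (l * n) = n * walkLength f x l := by
  induction n with
  | zero => simp [walkLength]
  | succ n ih =>
    have : f^[l * n] x = x := h.mul_const n
    rw [mul_add, mul_one, walkLength_add, ih, this]
    push_cast
    ring

theorem walkLength_iterate {x : X} {l : ℕ} (h : Function.IsPeriodicPt f l x) (n : ℕ) :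
    walkLength f (f^[n] x) l = walkLength f x l := by
  have h1 := walkLength_add f x n l
  have h2 := walkLength_add f x l n
  rw [show f^[l] x = x from h] at h2
  rw [add_comm] at h1
  linarith

theorem exists_walkLength_eq_natCast {x : X} {l : ℕ} (h : Function.IsPeriodicPt f l x) :
    ∃ w : ℕ, walkLength f x l = w := by
  have h1 := coe_walkLength f x l
  rw [show f^[l] x = x from h, sub_self, AddCircle.coe_eq_zero_iff] at h1
  obtain ⟨n, hn⟩ := h1
  have h0 := walkLength_nonneg f x l
  simp only [zsmul_eq_mul, mul_one] at hn
  rw [← hn] at h0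
  refine ⟨n.toNat, ?_⟩
  rw [← hn]
  exact_mod_cast (Int.toNat_of_nonneg (by exact_mod_cast h0)).symm

theorem windingNumber_orbit (x : X) :
    windingNumber (fun i : Fin (Function.minimalPeriod f x) =>
      ((f^[(i : ℕ)] x : X) : UnitAddCircle)) = walkLength f x (Function.minimalPeriod f x) := by
  rw [windingNumber, walkLength, Finset.sum_range]
  refine Finset.sum_congr rfl fun i _ => ?_
  have : f^[(finRotate _ i : ℕ)] x = f^[(i : ℕ) + 1] x := by
    rw [← Function.iterate_mod_minimalPeriod_eq (n := (i : ℕ) + 1)]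
    congr 2
    generalize Function.minimalPeriod f x = l at i
    cases l with
    | zero => exact i.elim0
    | succ l => rw [finRotate_apply, Fin.val_add, Fin.val_one', Nat.add_mod_mod]
  rw [this]

end walkLength

/-- If every orbit of `f` passes through `z`, and `z` is periodic, then the orbit of `z` is the only
periodic orbit. -/
theorem periodicOrbits_eq_singleton {α : Type*} {f : α → α} {z : α}
    (hz : z ∈ Function.periodicPts f) (h : ∀ x, ∃ i, f^[i] x = z) :
    periodicOrbits f = {Set.range fun i : ℕ => f^[i] z} := by
  refine Set.eq_singleton_iff_unique_mem.2 ⟨⟨z, hz, rfl⟩, ?_⟩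
  rintro _ ⟨x, ⟨n, hn, hx⟩, rfl⟩
  obtain ⟨i, hi⟩ := h x
  apply Set.Subset.antisymm
  · rintro _ ⟨j, rfl⟩
    -- Since `z = f^[i] x` and `n * i` is a multiple of the period, `n * i - i` further steps lead
    -- from `z` back to `x`.
    refine ⟨j + (n * i - i), ?_⟩
    have hle : i ≤ n * i := Nat.le_mul_of_pos_left i hn
    have hni : f^[n * i] x = x := hx.mul_const i
    simp only
    rw [← hi, ← Function.iterate_add_apply, add_assoc, Nat.sub_add_cancel hle,
      Function.iterate_add_apply, hni]
  · rintro _ ⟨j, rfl⟩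
    refine ⟨j + i, ?_⟩
    simp only
    rw [Function.iterate_add_apply, hi]

/-! ### Staircases force a single orbit -/

/-- Seen from a moving frame that advances by `p / q` per time unit, the first lifts of points of
`X` that lie at or after `b` come earlier and earlier as time runs from `0` to `q - 1`. -/
def HasStaircase (X : Finset UnitAddCircle) (p q : ℕ) : Prop :=
  ∃ (b : ℝ) (t : ℕ → ℝ),
    (∀ k < q, ((t k + k * (p / q : ℝ) : ℝ) : UnitAddCircle) ∈ X) ∧
    (∀ k < q, t k ∈ Set.Ico b (b + 1 / q)) ∧
    (∀ k < q, ∀ u, b ≤ u → ((u + k * (p / q : ℝ) : ℝ) : UnitAddCircle) ∈ X → t k ≤ u) ∧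
    ∀ k, k + 1 < q → t (k + 1) < t k

theorem exists_isGreatest_lift_lt {X : Finset UnitAddCircle} (hX : X.Nonempty) (b : ℝ) :
    ∃ z, IsGreatest {w : ℝ | (w : UnitAddCircle) ∈ X ∧ w < b} z := by
  obtain ⟨x, hx, hmax⟩ := X.exists_max_image
    (fun x => (AddCircle.equivIco 1 (b - 1) x : ℝ)) hX
  have key : ∀ y : UnitAddCircle, (AddCircle.equivIco 1 (b - 1) y : ℝ) < b := fun y => by
    linarith [(AddCircle.equivIco 1 (b - 1) y).2.2]
  refine ⟨AddCircle.equivIco 1 (b - 1) x, ⟨by rwa [AddCircle.coe_equivIco], key x⟩, ?_⟩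
  rintro w ⟨hw, hwb⟩
  rcases lt_or_ge w (b - 1) with h | h
  · exact h.le.trans (AddCircle.equivIco 1 (b - 1) x).2.1
  · have := hmax _ hw
    rwa [AddCircle.equivIco_coe_of_mem ⟨h, by linarith⟩] at this

section Staircase

variable {X : Finset UnitAddCircle} {p q : ℕ}

theorem mul_div_of_dvd (hq : 0 < q) {n : ℕ} (h : q ∣ n) : ∃ m : ℕ, (n : ℝ) * (p / q : ℝ) = m := by
  obtain ⟨c, rfl⟩ := h
  have : (q : ℝ) ≠ 0 := by positivity
  refine ⟨c * p, ?_⟩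
  push_cast
  field_simp

/-- In `q` steps the frame advances by the integer `p`, so only the time modulo `q` matters. -/
theorem coe_sub_mul_mod (hq : 0 < q) (u : ℝ) (k : ℕ) :
    ((u - k * (p / q : ℝ) + (k % q : ℕ) * (p / q : ℝ) : ℝ) : UnitAddCircle) = u := by
  obtain ⟨m, hm⟩ := mul_div_of_dvd (p := p) hq (Dvd.intro (k / q) rfl)
  have hk : (k : ℝ) = (k % q : ℕ) + (q * (k / q) : ℕ) := by exact_mod_cast (Nat.mod_add_div k q).symm
  rw [show u - k * (p / q : ℝ) + (k % q : ℕ) * (p / q : ℝ) = u - m by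
    rw [← hm]; nth_rewrite 1 [hk]; ring]
  exact coe_sub_natCast_circle u m

/-- A walk that starts at or after `b` in the moving frame arrives at the last lift `z` before `b`,
at a time divisible by `q`. -/
theorem exists_walk_arrives (hq : 0 < q) (hr0 : (0 : ℝ) < p / q) (hr1 : (p / q : ℝ) ≤ 1)
    {b z : ℝ} {t : ℕ → ℝ}
    (htX : ∀ k < q, ((t k + k * (p / q : ℝ) : ℝ) : UnitAddCircle) ∈ X)
    (htb : ∀ k < q, t k ∈ Set.Ico b (b + 1 / q))
    (htmin : ∀ k < q, ∀ u, b ≤ u → ((u + k * (p / q : ℝ) : ℝ) : UnitAddCircle) ∈ X → t k ≤ u)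
    (htdec : ∀ k, k + 1 < q → t (k + 1) < t k)
    (hz : IsGreatest {w : ℝ | (w : UnitAddCircle) ∈ X ∧ w < b} z)
    (k : ℕ) (x : X) (u : ℝ) (hu : (u : UnitAddCircle) = x) (hbu : b ≤ u - k * (p / q : ℝ)) :
    ∃ i : ℕ, u + walkLength (cyclicMap X (p / q) hr0) x i - (k + i : ℕ) * (p / q : ℝ) = z ∧
      q ∣ k + i := by
  set r : ℝ := p / q with hr
  set f := cyclicMap X r hr0 with hf
  -- As `X` is finite, each step loses at least a fixed `δ` in the moving frame, which bounds the
  -- number of steps spent beyond `b`.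
  obtain ⟨δ, hδ, hfδ⟩ : ∃ δ > 0, ∀ y : X, cwDist y (f y) ≤ r - δ := by
    have : Nonempty X := ⟨x⟩
    obtain ⟨y, hy⟩ := Finite.exists_max fun y : X => cwDist y (f y)
    refine ⟨r - cwDist y (f y), sub_pos.2 ((cyclicMap_eq_iff X r hr0 y _).1 rfl).1, fun v => ?_⟩
    linarith [hy v]
  obtain ⟨N, hN⟩ : ∃ N : ℕ, u - k * r - b < N * δ := by
    obtain ⟨N, hN⟩ := exists_nat_gt ((u - k * r - b) / δ)
    exact ⟨N, (div_lt_iff₀ hδ).1 hN⟩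
  induction N generalizing k x u with
  | zero => simp only [Nat.cast_zero, zero_mul] at hN; linarith
  | succ N ih =>
    have hstep := isGreatest_add_cwDist_cyclicMap hr0 hr1 hu
    rw [← hf] at hstep
    set v := u + cwDist x (f x) with hv
    have hvx : (v : UnitAddCircle) = f x := by
      rw [hv, AddCircle.coe_add, coe_cwDist, hu, add_sub_cancel]
    rcases le_or_gt b (v - (k + 1 : ℕ) * r) with hbv | hbv
    · obtain ⟨i, hi, hdvd⟩ := ih (k + 1) (f x) v hvx hbv (by
        have := hfδ x
        push_cast at hN ⊢
        linarith)
      refine ⟨1 + i, ?_, by rwa [← add_assoc]⟩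
      rw [walkLength_add, walkLength_one, ← add_assoc, ← add_assoc]
      exact hi
    · have hkq : k % q < q := Nat.mod_lt k hq
      rcases lt_or_ge (k % q + 1) q with hlt | hge
      -- The walk is at or beyond stair `k % q`, hence strictly beyond the next stair, which is an
      -- admissible target; so the step cannot fall below `b`.
      · exfalso
        have h1 : t (k % q) ≤ u - k * r := by
          refine htmin _ hkq _ hbu ?_
          rw [hr, coe_sub_mul_mod hq, hu]
          exact x.2
        have h2 := htdec _ hlt
        have h3 : t (k % q + 1) + (k + 1 : ℕ) * r ≤ v := by
          refine hstep.2 ⟨?_, by push_cast; linarith⟩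
          have hmod : k % q + 1 = (k + 1) % q := by
            rw [Nat.add_mod, ← Nat.mod_eq_of_lt hlt, Nat.add_mod (k % q) 1, Nat.mod_mod]
          have := coe_sub_mul_mod (p := p) hq (t (k % q + 1) + (k + 1 : ℕ) * r) (k + 1)
          rw [← this, ← hr, add_sub_cancel_right, ← hmod]
          exact htX _ hlt
        linarith [(htb _ hlt).1]
      -- The frame is now displaced by an integer, so the available points are the lifts of `X`
      -- itself, and the last one before `b` is `z`.
      · have hdvd : q ∣ k + 1 := by
          refine Nat.dvd_of_mod_eq_zero ?_
          rw [← Nat.mod_add_mod, show k % q + 1 = q by omega, Nat.mod_self]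
        obtain ⟨m, hm⟩ := mul_div_of_dvd (p := p) hq hdvd
        rw [← hr] at hm
        refine ⟨1, ?_, hdvd⟩
        rw [walkLength_one, ← hv]
        apply le_antisymm
        · refine hz.2 ⟨?_, hbv⟩
          rw [hm, coe_sub_natCast_circle, hvx]
          exact (f x).2
        · have : z + (k + 1 : ℕ) * r ≤ v := by
            refine hstep.2 ⟨?_, ?_⟩
            · rw [hm, coe_add_natCast_circle]
              exact hz.1.1
            · have := hz.1.2
              push_cast
              linarith
          linarith

theorem HasStaircase.hasSingleOrbit (hq : 0 < q) (hpq : p.Coprime q)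
    (hr0 : (0 : ℝ) < p / q) (hr1 : (p / q : ℝ) ≤ 1) (h : HasStaircase X p q) :
    HasSingleOrbit (cyclicMap X (p / q) hr0) p q := by
  obtain ⟨b, t, htX, htb, htmin, htdec⟩ := h
  obtain ⟨z, hz⟩ := exists_isGreatest_lift_lt ⟨_, htX 0 hq⟩ b
  have arrives := exists_walk_arrives hq hr0 hr1 htX htb htmin htdec hz
  set f := cyclicMap X (p / q) hr0
  have hq' : (0 : ℝ) < q := by exact_mod_cast hq
  let ζ : X := ⟨z, hz.1.1⟩
  have hreach : ∀ x : X, ∃ i, f^[i] x = ζ := by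
    intro x
    obtain ⟨i, hi, hdvd⟩ := arrives 0 x (AddCircle.equivIco 1 b x) AddCircle.coe_equivIco
      (by simpa using (AddCircle.equivIco 1 b (x : UnitAddCircle)).2.1)
    rw [zero_add] at hi hdvd
    obtain ⟨m, hm⟩ := mul_div_of_dvd (p := p) hq hdvd
    refine ⟨i, Subtype.ext ?_⟩
    have := congrArg (fun u : ℝ => (u : UnitAddCircle)) hi
    simp only [hm] at this
    rw [coe_sub_natCast_circle, AddCircle.coe_add, AddCircle.coe_equivIco, coe_walkLength,
      add_sub_cancel] at this
    exact this
  -- With `m ≡ -p⁻¹` modulo `q`, the lift `z + s` at time `m` has coordinate `z + 1 / q` in the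
  -- frame.
  obtain ⟨m, s, hms⟩ : ∃ m s : ℕ, m * p + 1 = s * q := by
    have : NeZero q := ⟨hq.ne'⟩
    refine ⟨(-(p : ZMod q)⁻¹).val, ((-(p : ZMod q)⁻¹).val * p + 1) / q, ?_⟩
    refine (Nat.div_mul_cancel ?_).symm
    rw [← ZMod.natCast_eq_zero_iff]
    push_cast
    rw [ZMod.natCast_val, ZMod.cast_id, neg_mul, mul_comm, ZMod.coe_mul_inv_eq_one p hpq,
      neg_add_cancel]
  have hms' : (m : ℝ) * (p / q) = s - 1 / q := by
    have : (m : ℝ) * p + 1 = s * q := by exact_mod_cast hms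
    field_simp
    linarith
  have hzb : b - 1 / q ≤ z := by
    have hmq := Nat.mod_lt m hq
    have h1 := htb _ hmq
    -- Up to integers, `m` steps of the frame amount to `-1 / q`; so this stair, moved back by `1 /
    -- q`, is a lift of a point of `X`, and it lies before `b`.
    have : t (m % q) - 1 / q ≤ z := by
      refine hz.2 ⟨?_, by linarith [h1.2]⟩
      have h2 := coe_sub_mul_mod (p := p) hq (t (m % q) - 1 / q + s) m
      rw [coe_add_natCast_circle] at h2
      rw [← h2, show t (m % q) - 1 / q + s - m * (p / q : ℝ) + (m % q : ℕ) * (p / q : ℝ) =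
        t (m % q) + (m % q : ℕ) * (p / q : ℝ) by rw [hms']; ring]
      exact htX _ hmq
    linarith [h1.1]
  -- This walk from `z` returns to `z` having lost exactly `1 / q` in the frame, whence `L p - w q =
  -- 1`.
  obtain ⟨L, hL, hLdvd⟩ := arrives m ζ (z + s) (coe_add_natCast_circle z s)
    (by rw [hms']; linarith)
  have hlen : walkLength f ζ L = (L * p - 1) / q := by
    push_cast at hL
    rw [add_mul, hms'] at hL
    have : walkLength f ζ L = L * (p / q) - 1 / q := by linarith
    rw [this]
    ring
  have hL0 : 0 < L := by
    rcases Nat.eq_zero_or_pos L with rfl | h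
    · simp [walkLength, neg_div, hq.ne'] at hlen
    · exact h
  obtain ⟨w, hw⟩ : ∃ w : ℤ, (L : ℤ) * p - 1 = q * w := by
    have h1 : (q : ℤ) ∣ ((m + L : ℕ) : ℤ) * p := (Int.natCast_dvd_natCast.2 hLdvd).mul_right _
    have h2 : (q : ℤ) ∣ ((m * p + 1 : ℕ) : ℤ) := Int.natCast_dvd_natCast.2 ⟨s, by rw [hms, mul_comm]⟩
    have := dvd_sub h1 h2
    push_cast at this
    obtain ⟨w, hw⟩ := this
    exact ⟨w, by rw [← hw]; ring⟩
  have hlenw : walkLength f ζ L = w := by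
    have : (L : ℝ) * p - 1 = q * w := by exact_mod_cast hw
    rw [hlen, this]
    field_simp
  have hper : Function.IsPeriodicPt f L ζ := by
    have := coe_walkLength f ζ L
    rw [hlenw, ← zero_add (w : ℝ), coe_add_intCast_circle, AddCircle.coe_zero] at this
    exact Subtype.ext (sub_eq_zero.1 this.symm)
  have hζ : ζ ∈ Function.periodicPts f := ⟨L, hL0, hper⟩
  have hmin := Function.isPeriodicPt_minimalPeriod f ζ
  obtain ⟨e, he⟩ := hper.minimalPeriod_dvd
  obtain ⟨w₀, hw₀⟩ := exists_walkLength_eq_natCast f hmin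
  refine ⟨_, periodicOrbits_eq_singleton hζ hreach, Function.minimalPeriod f ζ, w₀, ?_, ?_⟩
  · rintro _ ⟨i, rfl⟩
    have hmp := Function.minimalPeriod_apply_iterate hζ i
    refine ⟨hmp, ?_⟩
    rw [← hmp]
    refine (windingNumber_orbit f _).trans ?_
    rw [hmp, walkLength_iterate f hmin, hw₀]
  · have hwe : w = e * w₀ := by
      have := walkLength_mul f hmin e
      rw [← he, hlenw, hw₀] at this
      exact_mod_cast this
    -- `L` and `w` are `e` times the length and winding number of the orbit, so `e` divides `1`.
    have hprod : (e : ℤ) * ((Function.minimalPeriod f ζ : ℤ) * p - w₀ * q) = 1 := by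
      rw [he, hwe] at hw
      push_cast at hw
      linear_combination hw
    have he1 : (e : ℤ) = 1 :=
      Int.eq_one_of_mul_eq_one_right (Int.natCast_nonneg e) hprod
    rwa [he1, one_mul] at hprod

end Staircase

/-! ### Phases and colours -/

/-- The position of a point of the circle modulo `1 / q`, rescaled to `[0, 1)`. -/
noncomputable def phase (q : ℕ) (x : UnitAddCircle) : ℝ :=
  (AddCircle.equivIco 1 0 (q • x) : ℝ)

section phase

variable {q : ℕ}

theorem phase_mem_Ico (x : UnitAddCircle) : phase q x ∈ Set.Ico (0 : ℝ) 1 := by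
  simpa [phase] using (AddCircle.equivIco 1 0 (q • x)).2

theorem coe_phase (x : UnitAddCircle) : (phase q x : UnitAddCircle) = q • x :=
  AddCircle.coe_equivIco

theorem phase_eq_of_coe_eq {x : UnitAddCircle} {u : ℝ} (hu : u ∈ Set.Ico (0 : ℝ) 1)
    (h : (u : UnitAddCircle) = q • x) : phase q x = u := by
  rw [phase, ← h]
  exact AddCircle.equivIco_coe_of_mem (by simpa using hu)

theorem phase_eq_phase_iff {x y : UnitAddCircle} : phase q x = phase q y ↔ q • x = q • y := by
  refine ⟨fun h => ?_, fun h => by rw [phase, h, phase]⟩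
  rw [← coe_phase, h, coe_phase]

theorem measurable_phase : Measurable (phase q) :=
  measurable_subtype_coe.comp
    ((AddCircle.measurableEquivIco 1 0).measurable.comp (continuous_nsmul q).measurable)

variable [NeZero q]

theorem toAddCircle_natCast (m : ℕ) :
    ZMod.toAddCircle (m : ZMod q) = ((m / q : ℝ) : UnitAddCircle) := by
  simpa using ZMod.toAddCircle_intCast (N := q) m

theorem phase_add_toAddCircle (x : UnitAddCircle) (c : ZMod q) :
    phase q (x + ZMod.toAddCircle c) = phase q x := by
  rw [phase_eq_phase_iff, nsmul_add, ← map_nsmul, nsmul_eq_mul, ZMod.natCast_self, zero_mul,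
    map_zero, add_zero]

/-- The points of a given phase form a coset of the `q`-torsion; `e` is the colour of `x` within it.
-/
theorem exists_eq_phase_add (x : UnitAddCircle) :
    ∃ e : ZMod q, x = ((phase q x / q : ℝ) : UnitAddCircle) + ZMod.toAddCircle e := by
  obtain ⟨u, rfl⟩ := QuotientAddGroup.mk_surjective x
  have hq : (q : ℝ) ≠ 0 := NeZero.ne _
  obtain ⟨n, hn⟩ : ∃ n : ℤ, q * u = phase q (u : UnitAddCircle) + n := by
    apply exists_int_of_coe_eq
    rw [coe_phase, ← AddCircle.coe_nsmul, nsmul_eq_mul]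
  refine ⟨n, ?_⟩
  rw [ZMod.toAddCircle_intCast, ← AddCircle.coe_add]
  congr 1
  change u = phase q (u : UnitAddCircle) / q + n / q
  field_simp
  linarith

end phase

/-- There are `q` points of consecutive phases in the sample, whose colours are, in the order of
decreasing phase, the multiples `0, p, …, (q - 1) p` modulo `q`. -/
def HasBlock (p q : ℕ) [NeZero q] {n : ℕ} (x : Fin n → UnitAddCircle) : Prop :=
  ∃ i : Fin q → Fin n,
    (∀ k l, k < l → phase q (x (i l)) < phase q (x (i k))) ∧
    (∀ k, x (i k) = ((phase q (x (i k)) / q : ℝ) : UnitAddCircle) +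
      ZMod.toAddCircle ((p * (k : ℕ) : ℕ) : ZMod q)) ∧
    ∀ j k l, phase q (x (i k)) ≤ phase q (x j) → phase q (x j) ≤ phase q (x (i l)) →
      j ∈ Set.range i

section HasBlock

variable {p q : ℕ} [NeZero q] {n : ℕ}

theorem measurableSet_hasBlock : MeasurableSet {x : Fin n → UnitAddCircle | HasBlock p q x} := by
  have hm : ∀ j : Fin n, Measurable fun x : Fin n → UnitAddCircle => phase q (x j) :=
    fun j => measurable_phase.comp (measurable_pi_apply j)
  simp only [HasBlock, Set.ofPred_exists, Set.ofPred_and, Set.ofPred_forall]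
  refine MeasurableSet.iUnion fun i => ((MeasurableSet.iInter fun k => MeasurableSet.iInter fun l =>
    MeasurableSet.iInter fun _ => measurableSet_lt (hm _) (hm _)).inter
    ((MeasurableSet.iInter fun k => measurableSet_eq_fun (measurable_pi_apply _) ?_).inter
    (MeasurableSet.iInter fun j => MeasurableSet.iInter fun k => MeasurableSet.iInter fun l => ?_)))
  · exact (AddCircle.measurable_mk'.comp ((hm _).div_const _)).add_const _
  · exact (measurableSet_le (hm _) (hm _)).imp ((measurableSet_le (hm _) (hm _)).imp (.const _))

/-- The stairs are the phases of the block divided by `q`. A sample point undercutting stair `k`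
would have a phase within the block, hence belong to it, and its colour `p * k` would identify it as
the `k`-th member because `p` is invertible modulo `q`. -/
theorem HasBlock.hasStaircase (hpq : p.Coprime q) {x : Fin n → UnitAddCircle}
    (h : HasBlock p q x) : HasStaircase (sampleSet x) p q := by
  obtain ⟨i, hlt, hcol, hcons⟩ := h
  have hq : 0 < q := Nat.pos_of_neZero q
  have hq' : (0 : ℝ) < q := by exact_mod_cast hq
  have hmul : ∀ k : ℕ, (k : ℝ) * (p / q) = ((p * k : ℕ) : ℝ) / q := fun k => by
    push_cast; ring
  let last : Fin q := ⟨q - 1, by omega⟩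
  have hle : ∀ k, phase q (x (i last)) ≤ phase q (x (i k)) := by
    intro k
    rcases lt_or_ge k last with hk | hk
    · exact (hlt _ _ hk).le
    · rw [le_antisymm (Fin.le_def.2 (by simp only [last]; omega)) hk]
  refine ⟨phase q (x (i last)) / q,
    fun k => if hk : k < q then phase q (x (i ⟨k, hk⟩)) / q else 0, ?_, ?_, ?_, ?_⟩
  · intro k hk
    have := hcol ⟨k, hk⟩
    rw [toAddCircle_natCast, ← AddCircle.coe_add] at this
    beta_reduce
    rw [dif_pos hk, hmul, ← this]
    simp [sampleSet]
  · intro k hk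
    beta_reduce
    rw [dif_pos hk]
    refine ⟨by gcongr; exact hle _, ?_⟩
    rw [← add_div]
    gcongr
    linarith [(phase_mem_Ico (q := q) (x (i ⟨k, hk⟩))).2,
      (phase_mem_Ico (q := q) (x (i last))).1]
  · intro k hk u hbu hu
    beta_reduce
    rw [dif_pos hk]
    by_contra! hlt'
    obtain ⟨j, hj⟩ : ∃ j, x j = ((u + k * (p / q : ℝ) : ℝ) : UnitAddCircle) := by
      simpa [sampleSet] using hu
    rw [div_le_iff₀ hq'] at hbu
    rw [lt_div_iff₀ hq'] at hlt'
    have h0 := (phase_mem_Ico (q := q) (x (i last))).1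
    have h1 := (phase_mem_Ico (q := q) (x (i ⟨k, hk⟩))).2
    have hph : phase q (x j) = u * q := by
      refine phase_eq_of_coe_eq ⟨by linarith, by linarith⟩ ?_
      rw [hj, ← AddCircle.coe_nsmul, nsmul_eq_mul,
        show (q : ℝ) * (u + k * (p / q)) = u * q + (k * p : ℕ) by push_cast; field_simp,
        coe_add_natCast_circle]
    obtain ⟨l, rfl⟩ := hcons j last ⟨k, hk⟩ (by rwa [hph]) (by rw [hph]; exact hlt'.le)
    have hl := hcol l
    rw [hph, hj, hmul, AddCircle.coe_add, mul_div_cancel_right₀ _ hq'.ne',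
      ← toAddCircle_natCast, add_right_inj] at hl
    have hkl := (ZMod.natCast_eq_natCast_iff _ _ _).1 (ZMod.toAddCircle_injective q hl)
    have hkl' : k % q = l % q := Nat.ModEq.cancel_left_of_coprime hpq.symm hkl
    rw [Nat.mod_eq_of_lt hk, Nat.mod_eq_of_lt l.2] at hkl'
    subst hkl'
    exact absurd hph hlt'.ne'
  · intro k hk
    beta_reduce
    rw [dif_pos hk, dif_pos (by omega)]
    gcongr
    exact hlt _ _ (Fin.mk_lt_mk.2 (Nat.lt_succ_self k))

end HasBlock

/-! ### Counting colourings without a block -/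

/-- Functions on `M` blocks of length `q` and `s` further points that agree with the pattern `w` on
no block. -/
theorem card_avoid_pattern_le {A : Type*} [Fintype A] [DecidableEq A] (M q s : ℕ) (w : Fin q → A) :
    (Finset.univ.filter fun d : Fin (M * q + s) → A =>
      ∀ m : Fin M, ∃ j, d (Fin.castAdd s (finProdFinEquiv (m, j))) ≠ w j).card ≤
      (Fintype.card A ^ q - 1) ^ M * Fintype.card A ^ s := by
  calc _ ≤ ((Fintype.piFinset fun _ : Fin M => (Finset.univ.erase w)) ×ˢ
          (Finset.univ : Finset (Fin s → A))).card := by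
        refine Finset.card_le_card_of_injOn (fun d =>
          (fun m j => d (Fin.castAdd s (finProdFinEquiv (m, j))), fun i => d (Fin.natAdd _ i)))
          ?_ ?_
        · intro d hd
          simpa [Function.ne_iff] using hd
        · intro d _ d' _ h
          rw [Prod.mk.injEq] at h
          funext i
          refine Fin.addCases (fun i => ?_) (fun i => congrFun h.2 i) i
          have := congrFun (congrFun h.1 (finProdFinEquiv.symm i).1) (finProdFinEquiv.symm i).2
          simpa only [Prod.mk.eta, Equiv.apply_symm_apply] using this
    _ = _ := by simp [Finset.card_erase_of_mem]

section Rotations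

variable {p q : ℕ} [NeZero q] {n : ℕ}

/-- Sorting makes phases increase whereas the stairs descend, hence the reversal `j.rev`. -/
theorem hasBlock_of_pattern {M s : ℕ} {x : Fin (M * q + s) → UnitAddCircle}
    {σ : Equiv.Perm (Fin (M * q + s))} (hσ : StrictMono fun i => phase q (x (σ i)))
    {e : Fin (M * q + s) → ZMod q}
    (he : ∀ i, x i = ((phase q (x i) / q : ℝ) : UnitAddCircle) + ZMod.toAddCircle (e i))
    (m : Fin M)
    (hm : ∀ j : Fin q, e (σ (Fin.castAdd s (finProdFinEquiv (m, j)))) =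
      ((p * (j.rev : ℕ) : ℕ) : ZMod q)) : HasBlock p q x := by
  refine ⟨fun k => σ (Fin.castAdd s (finProdFinEquiv (m, k.rev))), fun k l hkl => ?_, fun k => ?_,
    fun j k l hk hl => ?_⟩
  · apply hσ
    rw [Fin.lt_def]
    simp only [Fin.val_castAdd, finProdFinEquiv_apply_val]
    have := Fin.lt_def.1 (Fin.rev_lt_rev.2 hkl)
    omega
  · have := hm k.rev
    rw [Fin.rev_rev] at this
    rw [← this]
    exact he _
  · obtain ⟨j, rfl⟩ := σ.surjective j
    have hk' := Fin.le_def.1 (hσ.le_iff_le.1 hk)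
    have hl' := Fin.le_def.1 (hσ.le_iff_le.1 hl)
    simp only [Fin.val_castAdd, finProdFinEquiv_apply_val] at hk' hl'
    have hl2 := l.rev.2
    refine ⟨Fin.rev ⟨j - q * m, by omega⟩, congrArg σ (Fin.ext ?_)⟩
    simp only [Fin.rev_rev, Fin.val_castAdd, finProdFinEquiv_apply_val]
    omega

open Classical in
-- Recolouring leaves the phases unchanged, so one sorting permutation serves every `c`, and `c` is
-- recovered from the resulting colours.
theorem card_not_hasBlock_le (M s : ℕ) {x : Fin (M * q + s) → UnitAddCircle}
    (hx : Function.Injective fun i => phase q (x i)) :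
    (Finset.univ.filter fun c : Fin (M * q + s) → ZMod q =>
      ¬ HasBlock p q (x + fun i => ZMod.toAddCircle (c i))).card ≤ (q ^ q - 1) ^ M * q ^ s := by
  choose e he using fun i => exists_eq_phase_add (q := q) (x i)
  set σ := Tuple.sort fun i => phase q (x i) with hσ
  have hmono : StrictMono fun i => phase q (x (σ i)) :=
    (Tuple.monotone_sort fun i => phase q (x i)).strictMono_of_injective (hx.comp σ.injective)
  have := card_avoid_pattern_le M q s (fun j : Fin q => ((p * (j.rev : ℕ) : ℕ) : ZMod q))
  rw [ZMod.card] at this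
  refine le_trans (Finset.card_le_card_of_injOn (fun c i => e (σ i) + c (σ i)) ?_ ?_) this
  · intro c hc
    simp only [Finset.coe_filter, Finset.mem_univ, true_and, Set.mem_ofPred_eq] at hc ⊢
    contrapose! hc
    obtain ⟨m, hm⟩ := hc
    refine hasBlock_of_pattern (σ := σ) (e := fun i => e i + c i) ?_ (fun i => ?_) m hm
    · simpa only [Pi.add_apply, phase_add_toAddCircle] using hmono
    · rw [Pi.add_apply, phase_add_toAddCircle, map_add, ← add_assoc, ← he]
  · intro c _ c' _ h
    funext i
    have := congrFun h (σ.symm i)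
    simpa using this

end Rotations

/-! ### Uniform samples -/

instance isProbabilityMeasure_unitAddCircle :
    IsProbabilityMeasure (volume : Measure UnitAddCircle) :=
  ⟨UnitAddCircle.measure_univ⟩

theorem volume_singleton_unitAddCircle (x : UnitAddCircle) :
    (volume : Measure UnitAddCircle) {x} = 0 := by
  rw [← (UnitAddCircle.measurePreserving_mk 0).measure_preimage
    (measurableSet_singleton x).nullMeasurableSet]
  refine Set.Countable.measure_zero ?_ _
  obtain ⟨u, rfl⟩ := QuotientAddGroup.mk_surjective x
  refine (Set.countable_range fun n : ℤ => u + n).mono fun v hv => ?_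
  obtain ⟨n, hn⟩ := exists_int_of_coe_eq (u := v) (v := u) hv
  exact ⟨n, hn.symm⟩

instance nullSingletonClass_unitAddCircle :
    NullSingletonClass (volume : Measure UnitAddCircle) :=
  ⟨volume_singleton_unitAddCircle⟩

theorem ae_injective_phase (q : ℕ) (hq : 0 < q) (n : ℕ) :
    ∀ᵐ x ∂(Measure.pi fun _ : Fin n => (volume : Measure UnitAddCircle)),
      Function.Injective fun i => phase q (x i) := by
  have key : ∀ i j : Fin n, i ≠ j →
      ∀ᵐ x ∂(Measure.pi fun _ : Fin n => (volume : Measure UnitAddCircle)),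
        q • x i ≠ q • x j := by
    intro i j hij
    have hind := (iIndepFun_pi (μ := fun _ : Fin n => (volume : Measure UnitAddCircle))
      (X := fun _ => id) (fun _ => aemeasurable_id)).indepFun hij
    have hmap := (indepFun_iff_map_prod_eq_prod_map_map
      (measurable_pi_apply i).aemeasurable (measurable_pi_apply j).aemeasurable).1 hind
    have hi := (measurePreserving_eval (fun _ : Fin n => (volume : Measure UnitAddCircle)) i).map_eq
    have hj := (measurePreserving_eval (fun _ : Fin n => (volume : Measure UnitAddCircle)) j).map_eq
    have hS : MeasurableSet {z : UnitAddCircle × UnitAddCircle | q • z.1 = q • z.2} :=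
      measurableSet_eq_fun ((continuous_nsmul q).measurable.comp measurable_fst)
        ((continuous_nsmul q).measurable.comp measurable_snd)
    have hnull : ((volume : Measure UnitAddCircle).prod volume)
        {z : UnitAddCircle × UnitAddCircle | q • z.1 = q • z.2} = 0 := by
      rw [Measure.measure_prod_null hS]
      -- For fixed `u`, the bad `v` differ from `u` by one of finitely many `q`-torsion points.
      refine Eventually.of_forall fun u => Set.Finite.measure_zero ?_ _
      refine ((AddCircle.finite_torsion (1 : ℝ) hq).image (u - ·)).subset fun v hv => ?_
      refine ⟨u - v, ?_, sub_sub_cancel u v⟩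
      change q • (u - v) = 0
      rw [nsmul_sub, sub_eq_zero]
      exact hv
    rw [ae_iff]
    simp only [ne_eq, not_not]
    have h2 : (Measure.pi fun _ : Fin n => (volume : Measure UnitAddCircle)).map
        (fun x => (x i, x j)) = (volume : Measure UnitAddCircle).prod volume := by
      refine hmap.trans ?_
      exact congrArg₂ _ hi hj
    rw [← h2, Measure.map_apply ((measurable_pi_apply i).prodMk (measurable_pi_apply j)) hS] at hnull
    exact hnull
  have : ∀ᵐ x ∂(Measure.pi fun _ : Fin n => (volume : Measure UnitAddCircle)),
      ∀ i j : Fin n, i ≠ j → q • x i ≠ q • x j := by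
    simpa only [ae_all_iff] using key
  filter_upwards [this] with x hx i j hij
  by_contra hne
  exact hx i j hne (phase_eq_phase_iff.1 hij)

/-- Translations by `q`-torsion preserve the product measure, so averaging over all `q ^ n` of them,
where `n = M * q + s`, replaces conditioning on the phases by the pointwise count of bad colourings.
-/
theorem measure_not_hasBlock_mul_le (p q : ℕ) [NeZero q] (M s : ℕ) :
    (Measure.pi fun _ : Fin (M * q + s) => (volume : Measure UnitAddCircle))
      {x | ¬ HasBlock p q x} * (q : ENNReal) ^ (M * q + s) ≤
      ((q ^ q - 1 : ℕ) : ENNReal) ^ M * (q : ENNReal) ^ s := by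
  classical
  set μ := Measure.pi fun _ : Fin (M * q + s) => (volume : Measure UnitAddCircle) with hμ
  set B : Set (Fin (M * q + s) → UnitAddCircle) := {x | ¬ HasBlock p q x}
  have hB : MeasurableSet B := measurableSet_hasBlock.compl
  let T : (Fin (M * q + s) → ZMod q) → (Fin (M * q + s) → UnitAddCircle) :=
    fun c i => ZMod.toAddCircle (c i)
  have hT : ∀ c, Measurable fun x : Fin (M * q + s) → UnitAddCircle => x + T c :=
    fun c => measurable_add_const _
  calc μ B * (q : ENNReal) ^ (M * q + s)
      = ∑ c : Fin (M * q + s) → ZMod q, μ ((· + T c) ⁻¹' B) := by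
        rw [Finset.sum_congr rfl fun c _ =>
          (measurePreserving_add_right μ (T c)).measure_preimage hB.nullMeasurableSet]
        simp [mul_comm]
    _ = ∫⁻ x, ∑ c : Fin (M * q + s) → ZMod q, ((· + T c) ⁻¹' B).indicator 1 x ∂μ := by
        rw [lintegral_finsetSum _ fun c _ => measurable_one.indicator (hT c hB)]
        exact Finset.sum_congr rfl fun c _ => (lintegral_indicator_one (hT c hB)).symm
    _ ≤ ∫⁻ _, ((q ^ q - 1 : ℕ) : ENNReal) ^ M * (q : ENNReal) ^ s ∂μ := by
        refine lintegral_mono_ae ?_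
        filter_upwards [ae_injective_phase q (Nat.pos_of_neZero q) (M * q + s)] with x hx
        have := card_not_hasBlock_le (p := p) M s hx
        calc _ = (((Finset.univ.filter fun c : Fin (M * q + s) → ZMod q =>
                ¬ HasBlock p q (x + T c)).card : ℕ) : ENNReal) := by
              rw [Finset.card_filter]
              push_cast
              refine Finset.sum_congr rfl fun c _ => ?_
              simp [Set.indicator_apply, B]
          _ ≤ _ := by exact_mod_cast this
    _ = _ := by simp

theorem measure_not_hasBlock_le (p q : ℕ) [NeZero q] (n : ℕ) :
    (Measure.pi fun _ : Fin n => (volume : Measure UnitAddCircle)) {x | ¬ HasBlock p q x} ≤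
      (((q ^ q - 1 : ℕ) : ENNReal) / (q : ENNReal) ^ q) ^ (n / q) := by
  obtain ⟨M, s, hM, rfl⟩ : ∃ M s, M = n / q ∧ n = M * q + s :=
    ⟨n / q, n % q, rfl, (Nat.div_add_mod' n q).symm⟩
  rw [← hM]
  have hq0 : (q : ENNReal) ≠ 0 := by exact_mod_cast NeZero.ne q
  have hpow0 : ∀ k : ℕ, (q : ENNReal) ^ k ≠ 0 := fun k => pow_ne_zero _ hq0
  have hpowt : ∀ k : ℕ, (q : ENNReal) ^ k ≠ ⊤ := fun k => ENNReal.pow_ne_top (ENNReal.natCast_ne_top q)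
  have := measure_not_hasBlock_mul_le p q M s
  rw [pow_add, ← mul_assoc] at this
  have h := (ENNReal.mul_le_mul_iff_left (hpow0 s) (hpowt s)).1 this
  rw [div_eq_mul_inv, mul_pow, ← ENNReal.inv_pow, ← div_eq_mul_inv,
    ENNReal.le_div_iff_mul_le (.inl (pow_ne_zero _ (hpow0 q)))
    (.inl (ENNReal.pow_ne_top (hpowt q))), ← pow_mul, mul_comm q M]
  exact h

theorem tendsto_pattern_bound (q : ℕ) [NeZero q] :
    Tendsto (fun n : ℕ => (((q ^ q - 1 : ℕ) : ENNReal) / (q : ENNReal) ^ q) ^ (n / q)) atTop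
      (𝓝 0) := by
  have hpos : 0 < q ^ q := Nat.pow_self_pos
  refine (ENNReal.tendsto_pow_atTop_nhds_zero_of_lt_one ?_).comp
    (Nat.tendsto_div_const_atTop (NeZero.ne q))
  rw [ENNReal.div_lt_iff (.inl (pow_ne_zero _ (by exact_mod_cast NeZero.ne q)))
    (.inl (ENNReal.pow_ne_top (ENNReal.natCast_ne_top q))), one_mul]
  exact_mod_cast Nat.sub_lt hpos one_pos

theorem theorem4p5 {Ω : ℕ → Type*} [∀ n, MeasurableSpace (Ω n)]
    (P : ∀ n, Measure (Ω n)) [∀ n, IsProbabilityMeasure (P n)]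
    (X : ∀ n, Fin n → Ω n → UnitAddCircle)
    (hunif : ∀ n i, HasLaw (X n i) (volume : Measure UnitAddCircle) (P n))
    (hindep : ∀ n, iIndepFun (X n) (P n))
    (r : ℝ) (hr0 : 0 < r) (hr1 : r ≤ 1)
    (p q : ℕ) (hq : 0 < q) (hpq : Nat.Coprime p q) (hr : r = (p : ℝ) / (q : ℝ)) :
    AsymptoticallyAlmostSurely P fun n =>
      {ω | HasSingleOrbit (cyclicMap (sampleSet fun i => X n i ω) r hr0) p q} := by
  subst hr
  have : NeZero q := ⟨hq.ne'⟩
  refine tendsto_of_tendsto_of_tendsto_of_le_of_le tendsto_const_nhds (tendsto_pattern_bound q)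
    (fun _ => zero_le) fun n => ?_
  have hae : ∀ i, AEMeasurable (X n i) (P n) := fun i => (hunif n i).aemeasurable
  have hmap : (P n).map (fun ω i => X n i ω) =
      Measure.pi fun _ : Fin n => (volume : Measure UnitAddCircle) := by
    rw [(iIndepFun_iff_map_fun_eq_pi_map hae).1 (hindep n)]
    simp only [(hunif n _).map_eq]
  refine le_trans ?_ (measure_not_hasBlock_le p q n)
  have hmeas : MeasurableSet {x : Fin n → UnitAddCircle | ¬ HasBlock p q x} :=
    measurableSet_hasBlock.compl
  rw [← hmap, Measure.map_apply_of_aemeasurable (aemeasurable_pi_lambda _ hae) hmeas]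
  refine measure_mono fun ω hω hblock => hω ?_
  exact (hblock.hasStaircase hpq).hasSingleOrbit hq hpq hr0 hr1
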